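/- **Notation.** For a compact Hausdorff space $X$, a $\cdot$-measure on $X$ is a functional $\mu:C(X,[0,1])\to[0,1]$ with $\mu(1_X)=1$, $\mu(\lambda_X\cdot\varphi)=\lambda\,\mu(\varphi)$ and $\mu(\varphi\vee\psi)=\mu(\varphi)\vee\mu(\psi)$ for all $\lambda\in[0,1]$ and $\varphi,\psi\in C(X,[0,1])$, where $\vee$ is the (pointwise) maximum and $\lambda_X$ is the constant function with value $\lambda$. Let $A^\cdot X\subset[0,1]^{C(X,[0,1])}$ be the set of all $\cdot$-measures on $X$, with the subspace topology of the product topology. A max-$\cdot$ convex compactum is a compact set $K\subset[0,1]^T$ ($T$ any set) such that $\lambda\cdot a\vee b\in K$ (coordinatewise operations) for all $a,b\in K$ and $\lambda\in[0,1]$. Its max-$\cdot$ barycenter map $\beta^\cdot_K:A^\cdot K\to K$ is the continuous map given by $\mathrm{pr}_t(\beta^\cdot_K(\mu))=\mu(\mathrm{pr}_t|_K)$ for all $t\in T$. The set $A^\cdot X\subset[0,1]^{C(X,[0,1])}$ is a max-$\cdot$ convex compactum. The product $K\times L$ of max-$\cdot$ convex compacta $K\subset[0,1]^S$ and $L\subset[0,1]^T$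 is a max-$\cdot$ convex compactum in $[0,1]^S\times[0,1]^T=[0,1]^{S\sqcup T}$. **Proposition 4.3.** Let $D=\{0,1\}$ be the two-point discrete space and let $K=A^\cdot D\times A^\cdot D$. Then the max-$\cdot$ barycenter map $\beta^\cdot_K:A^\cdot K\to K$ is not an open map, although the map $\beta^\cdot_{A^\cdot D}:A^\cdot(A^\cdot D)\to A^\cdot D$ is open. -/

import Mathlib

open scoped unitInterval

/-- A `·`-measure on `X`: a functional `C(X,[0,1]) → [0,1]` that is normed, homogeneous with respect
to multiplication by scalars in `[0,1]`, and preserves binary maxima. -/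
structure IsDotMeasure {X : Type*} [TopologicalSpace X] (μ : C(X, I) → I) : Prop where
  map_one : μ (ContinuousMap.const X 1) = 1
  map_mul : ∀ (c : I) (φ : C(X, I)), μ (ContinuousMap.const X c * φ) = c * μ φ
  map_sup : ∀ φ ψ : C(X, I), μ (φ ⊔ ψ) = μ φ ⊔ μ ψ

/-- The set `A^·(X)` of all `·`-measures inside the cube `[0,1]^{C(X,[0,1])}`. As a type it
carries the subspace topology of the product topology. -/
def dotMeasures (X : Type*) [TopologicalSpace X] : Set (C(X, I) → I) :=
  {μ | IsDotMeasure μ}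

/-- A max-`·` convex compactum in the cube `[0,1]^T`: a compact subset that contains
`c · a ∨ b` (coordinatewise) for all its points `a`, `b` and all `c ∈ [0,1]`. -/
structure DotConvexCompactum (T : Type*) where
  carrier : Set (T → I)
  isCompact : IsCompact carrier
  convex : ∀ a ∈ carrier, ∀ b ∈ carrier, ∀ c : I, (fun t => (c * a t) ⊔ b t) ∈ carrier

namespace IsDotMeasure

variable {X : Type*} [TopologicalSpace X] {μ : C(X, I) → I}

theorem mono (h : IsDotMeasure μ) {φ ψ : C(X, I)} (hle : φ ≤ ψ) : μ φ ≤ μ ψ := by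
  have := h.map_sup φ ψ
  rw [sup_eq_right.2 hle] at this
  rw [this]
  exact le_sup_left

theorem map_const (h : IsDotMeasure μ) (c : I) : μ (ContinuousMap.const X c) = c := by
  have := h.map_mul c (ContinuousMap.const X 1)
  rw [h.map_one, mul_one] at this
  rwa [show ContinuousMap.const X c * ContinuousMap.const X 1 = ContinuousMap.const X c from
    mul_one _] at this

theorem nonempty (h : IsDotMeasure μ) : Nonempty X := by
  by_contra hX
  rw [not_nonempty_iff] at hX
  have h0 := h.map_const 0
  have h1 := h.map_const 1
  have : ContinuousMap.const X (0 : I) = ContinuousMap.const X 1 := by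
    ext x
    exact hX.elim x
  rw [this, h1] at h0
  exact one_ne_zero h0

theorem exists_cap (ψ : C(X, I)) (e : I) (he : 0 < e) :
    ∃ g : C(X, I), ContinuousMap.const X e * g ≤ ψ ∧ ∀ y, e ≤ ψ y → g y = 1 := by
  have he' : (0 : ℝ) < e := he
  refine ⟨⟨fun y => ⟨min 1 ((ψ y : ℝ) / e), ?_, ?_⟩, ?_⟩, ?_, ?_⟩
  · exact le_min zero_le_one (div_nonneg (ψ y).2.1 he'.le)
  · exact min_le_left _ _
  · fun_prop
  · intro y
    change (e : ℝ) * min 1 ((ψ y : ℝ) / e) ≤ ψ y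
    calc (e : ℝ) * min 1 ((ψ y : ℝ) / e) ≤ e * ((ψ y : ℝ) / e) :=
          mul_le_mul_of_nonneg_left (min_le_right _ _) he'.le
      _ = ψ y := by field_simp
  · intro y hy
    apply Subtype.ext
    change min 1 ((ψ y : ℝ) / e) = 1
    exact min_eq_left ((one_le_div he').2 hy)

theorem exists_point [CompactSpace X] (h : IsDotMeasure μ) (φ : C(X, I)) :
    ∃ x, ∀ ψ : C(X, I), ψ x = 1 → μ φ ≤ φ x * μ ψ := by
  by_contra! hcon
  obtain ⟨x₀⟩ := h.nonempty
  have hc : 0 < μ φ := by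
    obtain ⟨ψ, -, hψ⟩ := hcon x₀
    exact lt_of_le_of_lt (unitInterval.nonneg') hψ
  have key : ∃ g : C(X, I), μ g < μ φ ∧ ∀ y ∈ (Set.univ : Set X), φ y ≤ g y := by
    refine isCompact_univ.induction_on
      (p := fun s => ∃ g : C(X, I), μ g < μ φ ∧ ∀ y ∈ s, φ y ≤ g y) ?_ ?_ ?_ ?_
    · exact ⟨ContinuousMap.const X 0, by rwa [h.map_const], by simp⟩
    · rintro s t hst ⟨g, hg, hgt⟩
      exact ⟨g, hg, fun y hy => hgt y (hst hy)⟩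
    · rintro s t ⟨g, hg, hgs⟩ ⟨g', hg', hgt⟩
      refine ⟨g ⊔ g', by rw [h.map_sup]; exact max_lt hg hg', ?_⟩
      rintro y (hy | hy)
      · exact (hgs y hy).trans le_sup_left
      · exact (hgt y hy).trans le_sup_right
    · intro x _
      obtain ⟨ψ, hψ1, hψ⟩ := hcon x
      have hψ' : (φ x : ℝ) * μ ψ < μ φ := hψ
      -- a small `ε` for which the strict inequality survives
      have hev : ∀ᶠ ε : ℝ in nhdsWithin 0 (Set.Ioi 0),
          ((φ x : ℝ) + ε) * μ ψ < (1 - ε) * μ φ := by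
        have h1 : Continuous fun ε : ℝ => ((φ x : ℝ) + ε) * μ ψ := by fun_prop
        have h2 : Continuous fun ε : ℝ => (1 - ε) * (μ φ : ℝ) := by fun_prop
        apply nhdsWithin_le_nhds
        exact h1.continuousAt.eventually_lt h2.continuousAt (by simpa using hψ')
      have hev1 : ∀ᶠ ε : ℝ in nhdsWithin 0 (Set.Ioi 0), ε ∈ Set.Ioo (0 : ℝ) 1 :=
        Ioo_mem_nhdsGT one_pos
      obtain ⟨ε, hε, hε0, hε1⟩ := (hev.and hev1).exists
      let e : I := ⟨1 - ε, by linarith, by linarith⟩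
      have he : 0 < e := by
        change (0 : ℝ) < 1 - ε
        linarith
      let d : I := ⟨min 1 ((φ x : ℝ) + ε),
        le_min zero_le_one (add_nonneg (φ x).2.1 hε0.le), min_le_left _ _⟩
      obtain ⟨g, hg, hg1⟩ := exists_cap ψ e he
      refine ⟨{y | (φ y : ℝ) < φ x + ε ∧ 1 - ε < (ψ y : ℝ)}, ?_,
        ContinuousMap.const X d * g, ?_, ?_⟩
      · rw [nhdsWithin_univ]
        have h1 : Continuous fun y => (φ y : ℝ) := by fun_prop
        have h2 : Continuous fun y => (ψ y : ℝ) := by fun_prop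
        refine Filter.Eventually.and
          (h1.continuousAt.eventually_lt_const (by linarith))
          (h2.continuousAt.eventually_const_lt ?_)
        change 1 - ε < ((ψ x : I) : ℝ)
        rw [hψ1]
        simpa using hε0
      · rw [h.map_mul]
        have h1 : (e : ℝ) * μ g ≤ μ ψ := by
          have := h.mono hg
          rw [h.map_mul] at this
          exact this
        change (d : ℝ) * μ g < μ φ
        have h2 : (d : ℝ) ≤ φ x + ε := min_le_right _ _
        have h3 : (0 : ℝ) ≤ μ g := (μ g).2.1
        have h4 : (0 : ℝ) ≤ φ x := (φ x).2.1
        have h5 : (1 - ε) * ((φ x + ε) * (μ g : ℝ)) ≤ (φ x + ε) * μ ψ := by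
          have := mul_le_mul_of_nonneg_left h1 (by linarith : (0 : ℝ) ≤ φ x + ε)
          change (φ x + ε) * ((1 - ε) * (μ g : ℝ)) ≤ _ at this
          linarith
        have h6 : (1 - ε) * ((φ x + ε) * (μ g : ℝ)) < (1 - ε) * μ φ := lt_of_le_of_lt h5 hε
        have h7 := lt_of_mul_lt_mul_left h6 (by linarith : (0 : ℝ) ≤ 1 - ε)
        exact lt_of_le_of_lt (mul_le_mul_of_nonneg_right h2 h3) h7
      · rintro y ⟨hy1, hy2⟩
        have : g y = 1 := hg1 y hy2.le
        change φ y ≤ d * g y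
        rw [this, mul_one]
        exact le_min (φ y).2.2 hy1.le
  obtain ⟨g, hg, hle⟩ := key
  exact absurd (h.mono (fun y => hle y trivial : φ ≤ g)) (not_le.2 hg)

theorem exists_atom [CompactSpace X] (h : IsDotMeasure μ) (φ : C(X, I)) :
    ∃ (x : X) (c : I), c * φ x = μ φ ∧ ∀ g : C(X, I), c * g x ≤ μ g := by
  obtain ⟨x, hx⟩ := h.exists_point φ
  rcases (unitInterval.nonneg' (t := φ x)).eq_or_lt with h0 | h0
  · refine ⟨x, 0, ?_, fun g => by simp⟩
    have := hx (ContinuousMap.const X 1) rfl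
    rw [← h0, zero_mul] at this
    rw [zero_mul]
    exact le_antisymm (unitInterval.nonneg') this
  · have h0' : (0 : ℝ) < φ x := h0
    have hle : (μ φ : ℝ) ≤ φ x := by
      have := hx (ContinuousMap.const X 1) rfl
      rw [h.map_one, mul_one] at this
      exact this
    refine ⟨x, ⟨(μ φ : ℝ) / φ x, div_nonneg (μ φ).2.1 h0'.le, (div_le_one h0').2 hle⟩, ?_, ?_⟩
    · apply Subtype.ext
      change (μ φ : ℝ) / φ x * φ x = μ φ
      field_simp
    · intro g
      rcases (unitInterval.nonneg' (t := g x)).eq_or_lt with hg | hg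
      · rw [← hg, mul_zero]
        exact unitInterval.nonneg'
      · obtain ⟨ψ, hψ, hψ1⟩ := exists_cap g (g x) hg
        have h1 : (μ φ : ℝ) ≤ φ x * μ ψ := hx ψ (hψ1 x le_rfl)
        have h2 : (g x : ℝ) * μ ψ ≤ μ g := by
          have := h.mono hψ
          rw [h.map_mul] at this
          exact this
        change (μ φ : ℝ) / φ x * g x ≤ μ g
        have h3 : (μ φ : ℝ) / φ x ≤ μ ψ := by
          rw [div_le_iff₀ h0']
          linarith
        calc (μ φ : ℝ) / φ x * g x ≤ μ ψ * g x := mul_le_mul_of_nonneg_right h3 (g x).2.1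
          _ = g x * μ ψ := mul_comm _ _
          _ ≤ μ g := h2

end IsDotMeasure

namespace DotConvexCompactum

/-- The coordinate function `pr_t|_K : K → [0,1]`. -/
def coord {T : Type*} (K : DotConvexCompactum T) (t : T) : C(K.carrier, I) where
  toFun x := x.1 t
  continuous_toFun := (continuous_apply t).comp continuous_subtype_val

/-- The point with coordinates `μ(pr_t|_K)` lies in `K`. -/
theorem barycenter_mem {T : Type*} (K : DotConvexCompactum T) {μ : C(K.carrier, I) → I}
    (h : IsDotMeasure μ) : (fun t => μ (K.coord t)) ∈ K.carrier := by
  classical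
  have : CompactSpace K.carrier := isCompact_iff_compactSpace.1 K.isCompact
  have key : ∀ F : Finset T, ∃ k ∈ K.carrier, (∀ t, k t ≤ μ (K.coord t)) ∧
      ∀ t ∈ F, k t = μ (K.coord t) := by
    intro F
    induction F using Finset.induction_on with
    | empty =>
      obtain ⟨x, c, hc, hx⟩ := h.exists_atom (ContinuousMap.const _ 1)
      have hc1 : c = 1 := by
        rw [h.map_one] at hc
        simpa using hc
      refine ⟨x.1, x.2, fun t => ?_, by simp⟩
      have := hx (K.coord t)
      rw [hc1, one_mul] at this
      exact this
    | insert s F _ ih =>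
      obtain ⟨k, hk, hle, heq⟩ := ih
      obtain ⟨x, c, hc, hx⟩ := h.exists_atom (K.coord s)
      refine ⟨_, K.convex x.1 x.2 k hk c, fun t => sup_le (hx (K.coord t)) (hle t), ?_⟩
      intro t ht
      rcases Finset.mem_insert.1 ht with rfl | ht
      · exact le_antisymm (sup_le (hx (K.coord _)) (hle _)) (hc.symm.le.trans le_sup_left)
      · exact le_antisymm (sup_le (hx (K.coord _)) (hle _)) ((heq t ht).symm.le.trans le_sup_right)
  choose k hk _ heq using key
  refine K.isCompact.isClosed.mem_of_tendsto (b := Filter.atTop) (f := k) ?_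
    (Filter.Eventually.of_forall hk)
  rw [tendsto_pi_nhds]
  intro t
  refine tendsto_const_nhds.congr' ?_
  filter_upwards [Filter.eventually_ge_atTop ({t} : Finset T)] with F hF
  exact (heq F t (hF (Finset.mem_singleton_self t))).symm

/-- The max-`·` barycenter map `β^·_K : A^·(K) → K`, given by `pr_t(β^·_K(μ)) = μ(pr_t|_K)`;
it is continuous. -/
def barycenter {T : Type*} (K : DotConvexCompactum T) : C(dotMeasures K.carrier, K.carrier) where
  toFun μ := ⟨fun t => μ.1 (K.coord t), K.barycenter_mem μ.2⟩
  continuous_toFun := by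
    refine Continuous.subtype_mk (continuous_pi fun t => ?_) _
    exact (continuous_apply (K.coord t)).comp
      (continuous_subtype_val (p := fun μ => μ ∈ dotMeasures K.carrier))

/-- The max-`·` convex compactum `A^·(X) ⊆ [0,1]^{C(X,[0,1])}`. -/
def free (X : Type*) [TopologicalSpace X] : DotConvexCompactum C(X, I) where
  carrier := dotMeasures X
  isCompact := by
    apply IsClosed.isCompact
    have : dotMeasures X = {μ : C(X, I) → I | μ (ContinuousMap.const X 1) = 1} ∩
        ((⋂ (c : I) (φ : C(X, I)), {μ | μ (ContinuousMap.const X c * φ) = c * μ φ}) ∩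
          ⋂ (φ : C(X, I)) (ψ : C(X, I)), {μ | μ (φ ⊔ ψ) = μ φ ⊔ μ ψ}) := by
      ext μ
      simp only [Set.mem_inter_iff, Set.mem_iInter, Set.mem_ofPred_eq, dotMeasures]
      exact ⟨fun h => ⟨h.1, h.2, h.3⟩, fun h => ⟨h.1, h.2.1, h.2.2⟩⟩
    rw [this]
    refine (isClosed_eq (by fun_prop) (by fun_prop)).inter (IsClosed.inter ?_ ?_)
    · exact isClosed_iInter fun c => isClosed_iInter fun φ =>
        isClosed_eq (by fun_prop) (by fun_prop)
    · exact isClosed_iInter fun φ => isClosed_iInter fun ψ =>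
        isClosed_eq (by fun_prop) ((continuous_apply φ).sup (continuous_apply ψ))
  convex := by
    intro a ha b hb c
    refine ⟨?_, fun d φ => ?_, fun φ ψ => ?_⟩
    · rw [hb.map_one]
      exact sup_eq_right.2 unitInterval.le_one'
    · rw [ha.map_mul, hb.map_mul, mul_left_comm, mul_max]
    · rw [ha.map_sup, hb.map_sup, mul_max]
      exact sup_sup_sup_comm _ _ _ _

/-- The product of two max-`·` convex compacta, with coordinatewise operations: under the
identification `[0,1]^S × [0,1]^T = [0,1]^{S ⊔ T}`, it is the set of points whose
`S`-part lies in `K` and whose `T`-part lies in `L`. -/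
def prod {S T : Type*} (K : DotConvexCompactum S) (L : DotConvexCompactum T) :
    DotConvexCompactum (S ⊕ T) where
  carrier := {x | x ∘ Sum.inl ∈ K.carrier ∧ x ∘ Sum.inr ∈ L.carrier}
  isCompact := by
    apply IsClosed.isCompact
    exact (K.isCompact.isClosed.preimage (by fun_prop :
        Continuous fun x : S ⊕ T → I => x ∘ Sum.inl)).inter
      (L.isCompact.isClosed.preimage (by fun_prop :
        Continuous fun x : S ⊕ T → I => x ∘ Sum.inr))
  convex := fun a ha b hb c =>
    ⟨K.convex _ ha.1 _ hb.1 c, L.convex _ ha.2 _ hb.2 c⟩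

end DotConvexCompactum

/-! A `·`-measure on `D` is a pair of weights with maximum 1, so `A^·D` is two unit segments glued
at `(1,1)`. Throughout, `IsDotMeasure.exists_atom` supplies, for each function `φ`, a scaled Dirac
measure below `μ` with the same value at `φ`.

The map for `A^·D` is open because every `M` lies on a right inverse continuous at its barycenter
`(a₀, b₀)`. If `a₀, b₀ > 0`, the value at `p` is `M` transported by multiplying the two weights by
`p₀/a₀` and `p₁/b₀` (`exists_section`). Transported points need not be normed, so test functions are
first extended homogeneously (`scale`). If `a₀` or `b₀` is zero, `M` is a Dirac measure and `p ↦
δ_p` works.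

For the square, `M = δ_(e₀,e₀) ∨ δ_(e₁,e₁)` has barycenter `((1,1),(1,1))`. A measure with
barycenter `((1,1),(1,r))`, `r < 1`, must have an atom of coefficient 1 whose first component has
second weight 1 and whose second component has first weight 1. No such point carries `M`, and one
test function detects this. -/

namespace unitInterval

/-- The quotient `u / w` truncated to the unit interval. -/
noncomputable def quot (u w : I) : I := Set.projIcc 0 1 zero_le_one ((u : ℝ) / w)

theorem mul_quot {u w : I} (hw : 0 < w) (h : u ≤ w) : w * quot u w = u := by
  have hw' : (0 : ℝ) < w := hw
  have hm : (u : ℝ) / w ∈ Set.Icc (0 : ℝ) 1 :=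
    ⟨div_nonneg u.2.1 hw'.le, (div_le_one hw').2 h⟩
  apply Subtype.ext
  rw [quot, Set.projIcc_of_mem _ hm]
  change (w : ℝ) * (u / w) = u
  field_simp

theorem quot_eq {u w t : I} (hw : 0 < w) (h : w * t = u) : quot u w = t := by
  have hu : u ≤ w := h ▸ mul_le_left
  exact mul_left_cancel₀ hw.ne' ((mul_quot hw hu).trans h.symm)

theorem continuous_quot {Y : Type*} [TopologicalSpace Y] {u w : Y → I} (hu : Continuous u)
    (hw : Continuous w) (h : ∀ y, 0 < w y) : Continuous fun y => quot (u y) (w y) := by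
  refine continuous_projIcc.comp (Continuous.div (by fun_prop) (by fun_prop) fun y => ?_)
  exact (show (0 : ℝ) < w y from h y).ne'

end unitInterval

open unitInterval

/-! ### Norm continuity and transport of `·`-measures. -/

namespace IsDotMeasure

variable {X Y : Type*} [TopologicalSpace X] [TopologicalSpace Y] {μ : C(X, I) → I}

theorem eval (x : X) : IsDotMeasure fun φ : C(X, I) => φ x :=
  ⟨rfl, fun _ _ => rfl, fun _ _ => rfl⟩

/-- An atom `c · δ_x` attaining `μ φ` gives `μ φ - μ ψ ≤ c (φ x - ψ x)`; exchanging `φ` and `ψ`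
gives the other bound. -/
theorem lipschitzWith [CompactSpace X] (h : IsDotMeasure μ) : LipschitzWith 1 μ := by
  have key : ∀ φ ψ : C(X, I), (μ φ : ℝ) - μ ψ ≤ dist φ ψ := by
    intro φ ψ
    obtain ⟨x, c, hc, hx⟩ := h.exists_atom φ
    have h1 : (c : ℝ) * ψ x ≤ μ ψ := hx ψ
    have h2 : (c : ℝ) * φ x = μ φ := congrArg Subtype.val hc
    have h3 : (φ x : ℝ) - ψ x ≤ dist φ ψ :=
      (le_abs_self _).trans (ContinuousMap.dist_apply_le_dist (f := φ) (g := ψ) x)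
    have h4 := mul_le_mul_of_nonneg_left h3 c.2.1
    have h5 := mul_le_of_le_one_left (dist_nonneg (x := φ) (y := ψ)) c.2.2
    linarith
  refine LipschitzWith.of_dist_le_mul fun φ ψ => ?_
  rw [NNReal.coe_one, one_mul]
  refine abs_le.2 ⟨?_, key φ ψ⟩
  have := key ψ φ
  rw [dist_comm] at this
  linarith

/-- A homogeneous max-preserving operator followed by a `·`-measure and divided by its total mass
is a `·`-measure. -/
theorem quot_comp (h : IsDotMeasure μ) (Φ : C(Y, I) → C(X, I)) {k : I} (hk : 0 < k)
    (h_one : μ (Φ (ContinuousMap.const Y 1)) = k)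
    (h_mul : ∀ (c : I) (φ : C(Y, I)),
      Φ (ContinuousMap.const Y c * φ) = ContinuousMap.const X c * Φ φ)
    (h_sup : ∀ φ ψ : C(Y, I), Φ (φ ⊔ ψ) = Φ φ ⊔ Φ ψ) :
    IsDotMeasure fun φ => quot (μ (Φ φ)) k := by
  have hle : ∀ φ, μ (Φ φ) ≤ k := by
    intro φ
    have hφ : φ ⊔ ContinuousMap.const Y 1 = ContinuousMap.const Y 1 :=
      sup_eq_right.2 fun _ => le_one'
    rw [← h_one]
    refine h.mono ?_
    rw [← hφ, h_sup]
    exact le_sup_left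
  refine ⟨quot_eq hk (by rw [mul_one, h_one]), fun c φ => quot_eq hk ?_, fun φ ψ => quot_eq hk ?_⟩
  · rw [mul_left_comm, mul_quot hk (hle φ), h_mul, h.map_mul]
  · rw [mul_max, mul_quot hk (hle φ), mul_quot hk (hle ψ), h_sup, h.map_sup]

end IsDotMeasure

/-! ### Measures on two points as pairs of weights. -/

/-- The indicator function of a point of the two-point space. -/
def indicator (i : Fin 2) : C(Fin 2, I) :=
  ⟨fun j => if j = i then 1 else 0, continuous_of_discreteTopology⟩

namespace IsDotMeasure

variable {μ : C(Fin 2, I) → I}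

theorem apply_eq (h : IsDotMeasure μ) (φ : C(Fin 2, I)) :
    μ φ = (φ 0 * μ (indicator 0)) ⊔ (φ 1 * μ (indicator 1)) := by
  rw [← h.map_mul, ← h.map_mul, ← h.map_sup]
  congr 1
  ext i
  fin_cases i <;> simp [indicator]

theorem sup_indicator (h : IsDotMeasure μ) : μ (indicator 0) ⊔ μ (indicator 1) = 1 := by
  have := h.apply_eq (ContinuousMap.const _ 1)
  rw [h.map_one] at this
  simpa using this.symm

end IsDotMeasure

/-- The `·`-measure on the two-point space with prescribed weights. -/
def ofWeights (a b : I) (h : a ⊔ b = 1) : dotMeasures (Fin 2) :=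
  ⟨fun φ => (φ 0 * a) ⊔ (φ 1 * b), by simpa using h,
    fun c _ => by simp [mul_max, mul_assoc],
    fun _ _ => by
      simp only [ContinuousMap.sup_apply, max_mul]
      exact sup_sup_sup_comm _ _ _ _⟩

@[simp] theorem ofWeights_indicator_zero (a b : I) (h : a ⊔ b = 1) :
    (ofWeights a b h).1 (indicator 0) = a := by
  simp [ofWeights, indicator]

@[simp] theorem ofWeights_indicator_one (a b : I) (h : a ⊔ b = 1) :
    (ofWeights a b h).1 (indicator 1) = b := by
  simp [ofWeights, indicator]

theorem dotMeasures_ext {p q : dotMeasures (Fin 2)}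
    (h0 : p.1 (indicator 0) = q.1 (indicator 0)) (h1 : p.1 (indicator 1) = q.1 (indicator 1)) :
    p = q := by
  apply Subtype.ext
  funext φ
  rw [p.2.apply_eq, q.2.apply_eq, h0, h1]

theorem continuous_ofWeights {Y : Type*} [TopologicalSpace Y] {a b : Y → I} (ha : Continuous a)
    (hb : Continuous b) (h : ∀ y, a y ⊔ b y = 1) :
    Continuous fun y => ofWeights (a y) (b y) (h y) :=
  Continuous.subtype_mk (continuous_pi fun _ =>
    (continuous_const.mul ha).max (continuous_const.mul hb)) _

/-- The `·`-measure on the two-point space with weights proportional to `u` and `v`. -/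
noncomputable def ofProportional (u v : I) (h : 0 < u ⊔ v) : dotMeasures (Fin 2) :=
  ofWeights (quot u (u ⊔ v)) (quot v (u ⊔ v)) <| mul_left_cancel₀ h.ne' <| by
    rw [mul_max, mul_quot h le_sup_left, mul_quot h le_sup_right, mul_one]

theorem sup_mul_ofProportional_zero {u v : I} (h : 0 < u ⊔ v) :
    (u ⊔ v) * (ofProportional u v h).1 (indicator 0) = u := by
  rw [ofProportional, ofWeights_indicator_zero, mul_quot h le_sup_left]

theorem sup_mul_ofProportional_one {u v : I} (h : 0 < u ⊔ v) :
    (u ⊔ v) * (ofProportional u v h).1 (indicator 1) = v := by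
  rw [ofProportional, ofWeights_indicator_one, mul_quot h le_sup_right]

theorem continuous_ofProportional {Y : Type*} [TopologicalSpace Y] {u v : Y → I}
    (hu : Continuous u) (hv : Continuous v) (h : ∀ y, 0 < u y ⊔ v y) :
    Continuous fun y => ofProportional (u y) (v y) (h y) :=
  continuous_ofWeights (continuous_quot hu (hu.max hv) h) (continuous_quot hv (hu.max hv) h) _

instance : CompactSpace (dotMeasures (Fin 2)) :=
  isCompact_iff_compactSpace.1 (DotConvexCompactum.free (Fin 2)).isCompact

/-- The weight of a `·`-measure on the two-point space at a point, as a continuous function. -/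
abbrev weight (i : Fin 2) : C(dotMeasures (Fin 2), I) :=
  (DotConvexCompactum.free (Fin 2)).coord (indicator i)

/-! ### Rescaling weights and homogeneous extension of functions. -/

theorem scaled_pos {s t : I} (hs : 0 < s) (ht : 0 < t) (x : dotMeasures (Fin 2)) :
    0 < (s * weight 0 x) ⊔ (t * weight 1 x) := by
  have h : weight 0 x ⊔ weight 1 x = 1 := x.2.sup_indicator
  rcases max_choice (weight 0 x) (weight 1 x) with h' | h' <;> rw [h'] at h <;> rw [h, mul_one]
  · exact hs.trans_le le_sup_left
  · exact ht.trans_le le_sup_right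

theorem continuous_scaled {Y : Type*} [TopologicalSpace Y] {s t : Y → I} (hs : Continuous s)
    (ht : Continuous t) (hs0 : ∀ y, 0 < s y) (ht0 : ∀ y, 0 < t y)
    (f : C(dotMeasures (Fin 2), I)) :
    Continuous fun z : Y × dotMeasures (Fin 2) =>
      ((s z.1 * weight 0 z.2) ⊔ (t z.1 * weight 1 z.2)) *
        f (ofProportional (s z.1 * weight 0 z.2) (t z.1 * weight 1 z.2)
          (scaled_pos (hs0 z.1) (ht0 z.1) z.2)) := by
  have h0 : Continuous fun z : Y × dotMeasures (Fin 2) => s z.1 * weight 0 z.2 := by fun_prop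
  have h1 : Continuous fun z : Y × dotMeasures (Fin 2) => t z.1 * weight 1 z.2 := by fun_prop
  exact (h0.max h1).mul (f.continuous.comp (continuous_ofProportional h0 h1 _))

/-- The operator on functions dual to scaling the two weights by `s` and `t`: the function is
extended homogeneously from normed weights to all weights. -/
noncomputable def scale (s t : I) (hs : 0 < s) (ht : 0 < t) (f : C(dotMeasures (Fin 2), I)) :
    C(dotMeasures (Fin 2), I) where
  toFun x := ((s * weight 0 x) ⊔ (t * weight 1 x)) *
    f (ofProportional (s * weight 0 x) (t * weight 1 x) (scaled_pos hs ht x))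
  continuous_toFun :=
    (continuous_scaled (Y := Unit) (s := fun _ => s) (t := fun _ => t) continuous_const
      continuous_const (fun _ => hs) (fun _ => ht) f).comp (Continuous.prodMk_right ())

section scale

variable {s t : I} (hs : 0 < s) (ht : 0 < t)

/-- Joint continuity in parameter and point curries to continuity into the function space, where
`·`-measures are Lipschitz. -/
theorem continuous_scale {Y : Type*} [TopologicalSpace Y] {s t : Y → I} (hs : Continuous s)
    (ht : Continuous t) (hs0 : ∀ y, 0 < s y) (ht0 : ∀ y, 0 < t y)
    (f : C(dotMeasures (Fin 2), I)) :
    Continuous fun y => scale (s y) (t y) (hs0 y) (ht0 y) f :=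
  ContinuousMap.continuous_of_continuous_uncurry _ (continuous_scaled hs ht hs0 ht0 f)

theorem scale_mul (c : I) (f : C(dotMeasures (Fin 2), I)) :
    scale s t hs ht (ContinuousMap.const _ c * f) =
      ContinuousMap.const _ c * scale s t hs ht f := by
  ext x : 1
  exact mul_left_comm _ _ _

theorem scale_sup (f g : C(dotMeasures (Fin 2), I)) :
    scale s t hs ht (f ⊔ g) = scale s t hs ht f ⊔ scale s t hs ht g := by
  ext x : 1
  exact mul_max _ _ _

theorem scale_one : scale s t hs ht (ContinuousMap.const _ 1) =
    (ContinuousMap.const _ s * weight 0) ⊔ (ContinuousMap.const _ t * weight 1) := by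
  ext x : 1
  exact mul_one _

/-- A weight is its own homogeneous extension, so the normalising factor cancels. This determines
the barycenter of a transported measure. -/
theorem scale_weight_zero : scale s t hs ht (weight 0) = ContinuousMap.const _ s * weight 0 := by
  ext x : 1
  exact sup_mul_ofProportional_zero (scaled_pos hs ht x)

theorem scale_weight_one : scale s t hs ht (weight 1) = ContinuousMap.const _ t * weight 1 := by
  ext x : 1
  exact sup_mul_ofProportional_one (scaled_pos hs ht x)

theorem scale_self (f : C(dotMeasures (Fin 2), I)) :
    scale s s hs hs f = ContinuousMap.const _ s * f := by
  ext x : 1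
  have h : (s * weight 0 x) ⊔ (s * weight 1 x) = s := by
    rw [← mul_max, show weight 0 x ⊔ weight 1 x = 1 from x.2.sup_indicator, mul_one]
  have hx : ofProportional (s * weight 0 x) (s * weight 1 x) (scaled_pos hs hs x) = x := by
    apply dotMeasures_ext
    · exact (ofWeights_indicator_zero _ _ _).trans (quot_eq (scaled_pos hs hs x) (by rw [h]; rfl))
    · exact (ofWeights_indicator_one _ _ _).trans (quot_eq (scaled_pos hs hs x) (by rw [h]; rfl))
  change _ * f _ = s * f x
  rw [h, hx]

end scale

theorem unitInterval.mul_pos' {a b : I} (ha : 0 < a) (hb : 0 < b) : 0 < a * b :=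
  pos_iff_ne_zero.2 (mul_ne_zero ha.ne' hb.ne')

/-! ### Openness for `A^·D`. -/

namespace IsDotMeasure

variable {μ : C(dotMeasures (Fin 2), I) → I}

/-- A `·`-measure on `A^·D` whose barycenter has a vanishing weight is a Dirac measure. -/
theorem eq_eval_of_weight_eq_zero (h : IsDotMeasure μ) {i : Fin 2} (hi : μ (weight i) = 0)
    {p : dotMeasures (Fin 2)} (hp : p.1 (indicator i) = 0) (f : C(dotMeasures (Fin 2), I)) :
    μ f = f p := by
  -- Every nonzero atom below `μ` has vanishing `i`-th weight, and normedness then fixes the other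
  -- weight as 1.
  have key : ∀ x : dotMeasures (Fin 2), ∀ c : I, c * weight i x ≤ μ (weight i) → c = 0 ∨ x = p := by
    intro x c hc
    rw [hi] at hc
    refine (mul_eq_zero.1 (le_antisymm hc nonneg')).imp id fun hx => ?_
    have hx' : x.1 (indicator i) = 0 := hx
    have h1 := x.2.sup_indicator
    have h2 := p.2.sup_indicator
    fin_cases i
    · simp only [Fin.zero_eta] at hx' hp
      rw [hx', sup_eq_right.2 nonneg'] at h1
      rw [hp, sup_eq_right.2 nonneg'] at h2
      exact dotMeasures_ext (hx'.trans hp.symm) (h1.trans h2.symm)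
    · simp only [Fin.mk_one] at hx' hp
      rw [hx', sup_eq_left.2 nonneg'] at h1
      rw [hp, sup_eq_left.2 nonneg'] at h2
      exact dotMeasures_ext (h1.trans h2.symm) (hx'.trans hp.symm)
  apply le_antisymm
  · obtain ⟨x, c, hc, hx⟩ := h.exists_atom f
    rw [← hc]
    rcases key x c (hx _) with rfl | rfl
    · rw [zero_mul]
      exact nonneg'
    · exact mul_le_right
  · obtain ⟨x, c, hc, hx⟩ := h.exists_atom (ContinuousMap.const _ 1)
    obtain rfl : c = 1 := by
      rw [h.map_one] at hc
      simpa using hc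
    rcases key x 1 (hx _) with h1 | rfl
    · exact absurd h1 one_ne_zero
    · simpa using hx f

theorem scaled (h : IsDotMeasure μ) {s t k : I} (hs : 0 < s) (ht : 0 < t) (hk : 0 < k)
    (hst : (s * μ (weight 0)) ⊔ (t * μ (weight 1)) = k) :
    IsDotMeasure fun f => quot (μ (scale s t hs ht f)) k :=
  h.quot_comp _ hk (by rw [scale_one, h.map_sup, h.map_mul, h.map_mul, hst])
    (scale_mul hs ht) (scale_sup hs ht)

end IsDotMeasure

/-- Rescaling by `p₀/a₀` and `p₁/b₀` moves the barycenter from `(a₀, b₀)` to `p` and is the identity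
at `p = (a₀, b₀)`. -/
theorem exists_section (M : dotMeasures (dotMeasures (Fin 2)))
    (h0 : 0 < M.1 (weight 0)) (h1 : 0 < M.1 (weight 1)) :
    ∃ g : dotMeasures (Fin 2) → dotMeasures (dotMeasures (Fin 2)),
      ContinuousAt g ((DotConvexCompactum.free (Fin 2)).barycenter M) ∧
      g ((DotConvexCompactum.free (Fin 2)).barycenter M) = M ∧
      Function.RightInverse g (DotConvexCompactum.free (Fin 2)).barycenter := by
  classical
  set a₀ := M.1 (weight 0) with ha₀
  set b₀ := M.1 (weight 1) with hb₀
  have hM : IsDotMeasure M.1 := M.2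
  have hk : 0 < a₀ * b₀ := mul_pos' h0 h1
  let U : Set (dotMeasures (Fin 2)) := {p | 0 < weight 0 p ∧ 0 < weight 1 p}
  have hU : IsOpen U := (isOpen_Ioi.preimage (weight 0).continuous).inter
    (isOpen_Ioi.preimage (weight 1).continuous)
  -- The ratios may exceed 1, so both are multiplied by `a₀ * b₀`, which keeps the factors in
  -- `[0,1]`; `quot` divides it out again.
  have hs : ∀ p : U, 0 < weight 0 p.1 * b₀ := fun p => mul_pos' p.2.1 h1
  have ht : ∀ p : U, 0 < weight 1 p.1 * a₀ := fun p => mul_pos' p.2.2 h0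
  have hst : ∀ p : U, (weight 0 p.1 * b₀ * a₀) ⊔ (weight 1 p.1 * a₀ * b₀) = a₀ * b₀ := by
    intro p
    rw [mul_assoc, mul_assoc, mul_comm b₀, ← max_mul,
      show weight 0 p.1 ⊔ weight 1 p.1 = 1 from p.1.2.sup_indicator, one_mul]
  let G : U → dotMeasures (dotMeasures (Fin 2)) := fun p =>
    ⟨fun f => quot (M.1 (scale _ _ (hs p) (ht p) f)) (a₀ * b₀),
      hM.scaled (hs p) (ht p) hk (hst p)⟩
  have hG : Continuous G := by
    refine Continuous.subtype_mk (continuous_pi fun f => ?_) _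
    refine continuous_quot (hM.lipschitzWith.continuous.comp ?_) continuous_const fun _ => hk
    exact continuous_scale (Y := U) (by fun_prop) (by fun_prop) hs ht f
  have hpU : (DotConvexCompactum.free (Fin 2)).barycenter M ∈ U := ⟨h0, h1⟩
  -- Off `U` any preimage of `p` will do: `U` is an open neighbourhood of the barycenter, so
  -- continuity there is unaffected.
  refine ⟨fun p => if hp : p ∈ U then G ⟨p, hp⟩ else ⟨_, IsDotMeasure.eval p⟩, ?_, ?_, ?_⟩
  · refine ContinuousOn.continuousAt (s := U) ?_ (hU.mem_nhds hpU)
    rw [continuousOn_iff_continuous_domRestrict]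
    convert hG using 1
    funext p
    exact dif_pos p.2
  · refine (dif_pos hpU).trans ?_
    apply Subtype.ext
    funext f
    refine quot_eq hk ?_
    have : scale _ _ (hs ⟨_, hpU⟩) (ht ⟨_, hpU⟩) f =
        ContinuousMap.const _ (a₀ * b₀) * f := by
      rw [← scale_self hk]
      congr 1
      exact mul_comm _ _
    rw [this, hM.map_mul]
  · intro p
    dsimp only
    split_ifs with hp
    · apply dotMeasures_ext
      · refine quot_eq hk ?_
        change _ = M.1 (scale _ _ (hs ⟨p, hp⟩) (ht ⟨p, hp⟩) (weight 0))
        rw [scale_weight_zero, hM.map_mul, ← ha₀, mul_comm]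
        exact (mul_left_comm _ _ _).trans (mul_comm _ _)
      · refine quot_eq hk ?_
        change _ = M.1 (scale _ _ (hs ⟨p, hp⟩) (ht ⟨p, hp⟩) (weight 1))
        rw [scale_weight_one, hM.map_mul, ← hb₀, mul_comm]
        exact (mul_assoc _ _ _).symm
    · rfl

theorem isOpenMap_barycenter_free_fin_two :
    IsOpenMap (DotConvexCompactum.free (Fin 2)).barycenter := by
  refine IsOpenMap.of_sections fun M => ?_
  by_cases h : 0 < M.1 (weight 0) ∧ 0 < M.1 (weight 1)
  · exact exists_section M h.1 h.2
  · have hi : ∃ i, M.1 (weight i) = 0 := by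
      by_contra! hne
      exact h ⟨pos_iff_ne_zero.2 (hne 0), pos_iff_ne_zero.2 (hne 1)⟩
    obtain ⟨i, hi⟩ := hi
    refine ⟨fun p => ⟨_, IsDotMeasure.eval p⟩, ?_, ?_, fun p => rfl⟩
    · exact (Continuous.subtype_mk (continuous_pi fun f => f.continuous) _).continuousAt
    · apply Subtype.ext
      funext f
      exact (IsDotMeasure.eq_eval_of_weight_eq_zero M.2 hi hi f).symm

/-! ### Failure of openness for the square. -/

namespace DotConvexCompactum

/-- The square `A^·D × A^·D`. -/
abbrev freeSq : DotConvexCompactum (C(Fin 2, I) ⊕ C(Fin 2, I)) :=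
  (free (Fin 2)).prod (free (Fin 2))

/-- A point of `A^·D × A^·D` given by its two components. -/
def pair (p q : dotMeasures (Fin 2)) : freeSq.carrier :=
  ⟨Sum.elim p.1 q.1, p.2, q.2⟩

theorem not_isOpenMap_barycenter_freeSq : ¬ IsOpenMap freeSq.barycenter := by
  intro hopen
  have : CompactSpace freeSq.carrier := isCompact_iff_compactSpace.1 freeSq.isCompact
  let b : C(freeSq.carrier, I) := freeSq.coord (Sum.inl (indicator 1))
  let c : C(freeSq.carrier, I) := freeSq.coord (Sum.inr (indicator 0))
  let d : C(freeSq.carrier, I) := freeSq.coord (Sum.inr (indicator 1))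
  let e₀ : dotMeasures (Fin 2) := ofWeights 1 0 (by simp)
  let e₁ : dotMeasures (Fin 2) := ofWeights 0 1 (by simp)
  let M : dotMeasures freeSq.carrier :=
    ⟨_, (free freeSq.carrier).convex _ (IsDotMeasure.eval (pair e₀ e₀)) _
      (IsDotMeasure.eval (pair e₁ e₁)) 1⟩
  -- At each of the two points carrying `M`, one of `b`, `c` vanishes, so `M` gives `b ⊓ c` the
  -- value 0.
  let V : Set (dotMeasures freeSq.carrier) := {N | N.1 (b ⊓ c) < 1}
  have hV : IsOpen V :=
    isOpen_lt ((continuous_apply (b ⊓ c)).comp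
      (continuous_subtype_val (p := fun μ => μ ∈ dotMeasures freeSq.carrier))) continuous_const
  have hMV : M ∈ V := by
    have h0 : b (pair e₀ e₀) = 0 := ofWeights_indicator_one 1 0 (by simp)
    have h1 : c (pair e₁ e₁) = 0 := ofWeights_indicator_zero 0 1 (by simp)
    change (1 * (b (pair e₀ e₀) ⊓ c (pair e₀ e₀))) ⊔ (b (pair e₁ e₁) ⊓ c (pair e₁ e₁)) < 1
    rw [h0, h1, inf_eq_left.2 nonneg', inf_eq_right.2 nonneg']
    simp
  let P : I → freeSq.carrier := fun r =>
    pair (ofWeights 1 1 (by simp)) (ofWeights 1 r (sup_eq_left.2 le_one'))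
  have hP : Continuous P := by
    refine Continuous.subtype_mk (continuous_pi fun i => ?_) _
    rcases i with i | i
    · exact continuous_const
    · exact continuous_const.max (continuous_const.mul continuous_id)
  have hP1 : P 1 = freeSq.barycenter M := by
    apply Subtype.ext
    funext i
    rcases i with φ | φ
    · change (φ 0 * 1) ⊔ (φ 1 * 1) =
        (1 * ((φ 0 * 1) ⊔ (φ 1 * 0))) ⊔ ((φ 0 * 0) ⊔ (φ 1 * 1))
      simp
    · change (φ 0 * 1) ⊔ (φ 1 * 1) =
        (1 * ((φ 0 * 1) ⊔ (φ 1 * 0))) ⊔ ((φ 0 * 0) ⊔ (φ 1 * 1))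
      simp
  have hnhds : P ⁻¹' (freeSq.barycenter '' V) ∈ nhds (1 : I) :=
    ((hopen V hV).preimage hP).mem_nhds ⟨M, hMV, hP1.symm⟩
  obtain ⟨r, hr, N, hN, hNr⟩ : ∃ r < (1 : I), P r ∈ freeSq.barycenter '' V := by
    obtain ⟨l, hl, hsub⟩ := exists_Ioc_subset_of_mem_nhds hnhds ⟨0, zero_lt_one⟩
    obtain ⟨r, hlr, hr1⟩ := exists_between hl
    exact ⟨r, hr1, hsub ⟨hlr, hr1.le⟩⟩
  have hNd : IsDotMeasure N.1 := N.2
  have hb : N.1 b = 1 := (congrArg b hNr).trans (ofWeights_indicator_one 1 1 (by simp))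
  have hd : N.1 d = r := (congrArg d hNr).trans
    (ofWeights_indicator_one 1 r (sup_eq_left.2 le_one'))
  -- Since `N.1 b = 1`, this atom has coefficient 1 and `b x = 1`. Then `d x ≤ r < 1`, so normedness
  -- of the second component forces `c x = 1` and hence `N.1 (b ⊓ c) = 1`.
  obtain ⟨x, m, hm, hx⟩ := hNd.exists_atom b
  rw [hb] at hm
  have hm1 : m = 1 := le_antisymm le_one' (hm ▸ mul_le_left)
  have hbx : b x = 1 := by rwa [hm1, one_mul] at hm
  have hdx : d x < 1 := by
    have := hx d
    rw [hm1, one_mul, hd] at this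
    exact this.trans_lt hr
  have hcx : c x = 1 := by
    have h : c x ⊔ d x = 1 := IsDotMeasure.sup_indicator x.2.2
    rcases max_choice (c x) (d x) with h' | h'
    · rwa [h'] at h
    · rw [h'] at h
      exact absurd h hdx.ne
  have := hx (b ⊓ c)
  rw [hm1, one_mul, ContinuousMap.inf_apply, hbx, hcx, inf_idem] at this
  exact absurd hN (not_lt.2 this)

end DotConvexCompactum

/-- For the two-point discrete space `D = {0, 1}`, the max-`·` barycenter map of the product
`A^·D × A^·D` is not open, although the max-`·` barycenter map of `A^·D` is open. -/
theorem proposition4p3 :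
    (¬ IsOpenMap (((DotConvexCompactum.free (Fin 2)).prod
        (DotConvexCompactum.free (Fin 2))).barycenter)) ∧
      IsOpenMap ((DotConvexCompactum.free (Fin 2)).barycenter) :=
  ⟨DotConvexCompactum.not_isOpenMap_barycenter_freeSq, isOpenMap_barycenter_free_fin_two⟩
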